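/- Let $k$ be a field and $S = k[x_1, x_2, \ldots]$ the polynomial ring in countably infinitely many variables, graded by $\deg x_i = d_i \in \mathbb{Z}_{\ge 0}$, where the $d_i$ are such that for every integer $n \ge 0$ there are only finitely many monomials of degree $n$. For a graded $k$-algebra $R = \bigoplus_{n \ge 0} R_n$ with all $\dim_k R_n$ finite, let $H_R(T) = \sum_{n \ge 0} (\dim_k R_n)\, T^n \in \mathbb{Z}[[T]]$ be its Hilbert series. Let $\Omega$ be a well-ordered set and let $\mathcal{T} = \{ f_\alpha \mid \alpha \in \Omega \}$ be a homogeneous regular sequence on $S$ indexed by $\Omega$: every $f_\alpha \in S$ is homogeneous, $S/(f_\alpha \mid \alpha \in \Omega)S \ne 0$, and for every $\alpha \in \Omega$ the element $f_\alpha$ is a non-zero-divisor on $S/(f_\beta \mid \beta < \alpha)S$. Let $I = (f_\alpha \mid \alpha \in \Omega)S$ be the homogeneous ideal generated by $\mathcal{T}$, and give $S/I$ the induced grading. Then, in $\mathbb{Z}[[T]]$ with the topology of coefficientwise convergence, both infinite products below converge (as limits of the net of finite partial products), and $$ H_S(T) = \prod_{i=1}^{\infty} \frac{1}{1 - T^{d_i}},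 \qquad H_{S/I}(T) = H_S(T) \cdot \prod_{f \in \mathcal{T}} \bigl(1 - T^{\deg f}\bigr). $$ -/

import Mathlib

open scoped PowerSeries PowerSeries.WithPiTopology

/-- A family `f` of elements of a commutative ring `R`, indexed by a well-ordered set `Ω`, is a
regular sequence on `R` if `R / (f α | α ∈ Ω) ≠ 0` and, for every `α`, the class of `f α` is a
non-zero-divisor on `R / (f β | β < α)`. -/
structure IsRegularSequence {R Ω : Type*} [CommRing R] [LinearOrder Ω] [WellFoundedLT Ω]
    (f : Ω → R) : Prop where
  nontrivial_quotient : Nontrivial (R ⧸ Ideal.span (Set.range f))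
  mem_nonZeroDivisors : ∀ α : Ω,
    Ideal.Quotient.mk (Ideal.span (f '' Set.Iio α)) (f α) ∈
      nonZeroDivisors (R ⧸ Ideal.span (f '' Set.Iio α))

/-- A regular sequence consisting of homogeneous elements with respect to the grading `𝒜`. -/
structure IsHomogeneousRegularSequence {k R Ω : Type*} [Field k] [CommRing R] [Algebra k R]
    (𝒜 : ℕ → Submodule k R) [LinearOrder Ω] [WellFoundedLT Ω] (f : Ω → R) : Prop where
  isRegularSequence : IsRegularSequence f
  isHomogeneousElem : ∀ α : Ω, SetLike.IsHomogeneousElem 𝒜 (f α)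

/-- The induced grading on the quotient `R / I` of a graded `k`-algebra `R = ⨁ 𝒜 n`
(by a homogeneous ideal `I`): its degree `n` part is the image of `𝒜 n`. -/
def quotientGrading {k R : Type*} [Field k] [CommRing R] [Algebra k R]
    (𝒜 : ℕ → Submodule k R) (I : Ideal R) : ℕ → Submodule k (R ⧸ I) :=
  fun n => (𝒜 n).map (Ideal.Quotient.mkₐ k I).toLinearMap

/-- The Hilbert series `∑ (dim_k A_n) T ^ n` of a `k`-algebra graded by finite-dimensional
subspaces `𝒜 n`. -/
noncomputable def hilbertSeries {k A : Type*} [Field k] [CommRing A] [Algebra k A]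
    (𝒜 : ℕ → Submodule k A) : ℤ⟦X⟧ :=
  PowerSeries.mk fun n => (Module.finrank k (𝒜 n) : ℤ)

/-! Everything is checked modulo `X ^ (n + 1)`, that is, in degrees at most `n`. A regular sequence
is linearly independent over `k`, so finite-dimensionality of the graded pieces leaves finitely many
`f α` of degree at most `n`. Let `F` be a finite set of indices containing all of these. In degrees
at most `n`, the ideals generated by `F` and by the whole sequence agree, and each member of `F`
still acts injectively modulo its predecessors in `F`. Hence each member, of degree `e`, multiplies
the Hilbert series by `1 - T ^ e` up to degree `n` (`finrank_quotientGrading_sup_add`), which gives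
convergence and the value together (`IsRegularSequence.eventually_X_pow_dvd`).

The formula for `H_S` is the same statement for the sequence of variables, whose quotient is `k`
with Hilbert series `1`. -/

section GradedRing

variable {k R : Type*} [Field k] [CommRing R] [Algebra k R] (𝒜 : ℕ → Submodule k R)

theorem finrank_quotientGrading_add [∀ n, FiniteDimensional k (𝒜 n)] (J : Ideal R) (n : ℕ) :
    Module.finrank k (quotientGrading 𝒜 J n) +
      Module.finrank k ↥(𝒜 n ⊓ J.restrictScalars k) = Module.finrank k (𝒜 n) := by
  set φ := (Ideal.Quotient.mkₐ k J).toLinearMap.domRestrict (𝒜 n) with hφ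
  have h1 : LinearMap.range φ = quotientGrading 𝒜 J n := by
    rw [hφ, LinearMap.range_domRestrict]; rfl
  have h2 : (LinearMap.ker φ).map (𝒜 n).subtype = 𝒜 n ⊓ J.restrictScalars k := by
    ext x
    simp [hφ, Ideal.Quotient.eq_zero_iff_mem, and_comm]
  rw [← LinearMap.finrank_range_add_finrank_ker φ, h1, ← h2,
    LinearEquiv.finrank_eq (Submodule.equivMapOfInjective _ (𝒜 n).subtype_injective _)]

theorem hilbertSeries_quotientGrading_bot [∀ n, FiniteDimensional k (𝒜 n)] :
    hilbertSeries (quotientGrading 𝒜 (⊥ : Ideal R)) = hilbertSeries 𝒜 := by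
  ext n
  have := finrank_quotientGrading_add 𝒜 ⊥ n
  have h : 𝒜 n ⊓ (⊥ : Ideal R).restrictScalars k = ⊥ := by simp
  rw [h, finrank_bot, add_zero] at this
  simp [hilbertSeries, this]

/-! ### Finiteness of a regular sequence in bounded degree -/

theorem IsRegularSequence.notMem_span {Ω : Type*} [LinearOrder Ω] [WellFoundedLT Ω] {f : Ω → R}
    (hf : IsRegularSequence f) (a : Ω) : f a ∉ Ideal.span (f '' Set.Iio a) := by
  intro h
  have h1 := hf.mem_nonZeroDivisors a
  rw [Ideal.Quotient.eq_zero_iff_mem.2 h] at h1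
  have h2 : Ideal.span (f '' Set.Iio a) ≠ ⊤ := fun h => by
    have := Ideal.Quotient.nontrivial_iff.1 hf.nontrivial_quotient
    exact this (top_le_iff.1 (h ▸ Ideal.span_mono (Set.image_subset_range _ _)))
  have := Ideal.Quotient.nontrivial_iff.2 h2
  exact zero_notMem_nonZeroDivisors h1

/-- In a nontrivial relation, the term with the largest index would lie in the ideal of its
predecessors. -/
theorem IsRegularSequence.linearIndependent {Ω : Type*} [LinearOrder Ω] [WellFoundedLT Ω]
    {f : Ω → R} (hf : IsRegularSequence f) : LinearIndependent k f := by
  classical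
  rw [linearIndependent_iff']
  intro s g hg
  by_contra! h
  obtain ⟨i, hi, hgi⟩ := h
  have hne : (s.filter (g · ≠ 0)).Nonempty := ⟨i, by simp [hi, hgi]⟩
  set a := (s.filter (g · ≠ 0)).max' hne with ha
  have ham : a ∈ s.filter (g · ≠ 0) := Finset.max'_mem _ _
  obtain ⟨has, hga⟩ := Finset.mem_filter.1 ham
  rw [← Finset.add_sum_erase _ _ has] at hg
  have hmem : g a • f a ∈ Ideal.span (f '' Set.Iio a) := by
    rw [eq_neg_of_add_eq_zero_left hg]
    refine neg_mem (sum_mem fun b hb => ?_)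
    obtain ⟨hba, hbs⟩ := Finset.mem_erase.1 hb
    by_cases hgb : g b = 0
    · simp [hgb]
    · have : b ≤ a := Finset.le_max' _ _ (by simp [hbs, hgb])
      exact Submodule.smul_of_tower_mem _ _ (Ideal.subset_span ⟨b, lt_of_le_of_ne this hba, rfl⟩)
  refine hf.notMem_span a ?_
  simpa [hga] using Submodule.smul_of_tower_mem _ (g a)⁻¹ hmem

variable {𝒜} in
theorem IsRegularSequence.finite_degree_le {Ω : Type*} [LinearOrder Ω] [WellFoundedLT Ω] {f : Ω → R}
    (hf : IsRegularSequence f) [∀ n, FiniteDimensional k (𝒜 n)] {δ : Ω → ℕ}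
    (hδ : ∀ a, f a ∈ 𝒜 (δ a)) (n : ℕ) :
    {a | δ a ≤ n}.Finite := by
  have : {a | δ a ≤ n} = ⋃ m ∈ Set.Iic n, {a | δ a = m} := by ext; simp
  rw [this]
  refine (Set.finite_Iic n).biUnion fun m _ => ?_
  have hli : LinearIndependent k fun a : {a | δ a = m} => (⟨f a, by
      have := hδ a; rwa [show δ a = m from a.2] at this⟩ : 𝒜 m) :=
    LinearIndependent.of_comp (𝒜 m).subtype (hf.linearIndependent.comp _ Subtype.val_injective)
  exact Set.finite_coe_iff.1 hli.finite

/-! ### Homogeneous ideals and one-generator extensions -/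

variable [GradedAlgebra 𝒜]

/-- A homogeneous element of degree `m` in an ideal spanned by homogeneous elements already lies in
the ideal spanned by the generators of degree at most `m`. -/
theorem mem_span_image_degree_le {Ω : Type*} {f : Ω → R} {δ : Ω → ℕ} (hδ : ∀ a, f a ∈ 𝒜 (δ a))
    (s : Set Ω) {m : ℕ} {g : R} (hg : g ∈ 𝒜 m) (h : g ∈ Ideal.span (f '' s)) :
    g ∈ Ideal.span (f '' {a ∈ s | δ a ≤ m}) := by
  suffices ∀ x ∈ Ideal.span (f '' s),
      (DirectSum.decompose 𝒜 x m : R) ∈ Ideal.span (f '' {a ∈ s | δ a ≤ m}) by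
    simpa [DirectSum.decompose_of_mem_same 𝒜 hg] using this g h
  intro x hx
  induction hx using Submodule.span_induction with
  | mem x hx =>
    obtain ⟨a, ha, rfl⟩ := hx
    by_cases ham : δ a = m
    · subst ham
      rw [DirectSum.decompose_of_mem_same 𝒜 (hδ a)]
      exact Ideal.subset_span ⟨a, ⟨ha, le_rfl⟩, rfl⟩
    · rw [DirectSum.decompose_of_mem_ne 𝒜 (hδ a) ham]
      exact zero_mem _
  | zero => simp
  | add x y _ _ hx hy => simpa using add_mem hx hy
  | smul r x hx' _ =>
    -- The hypothesis on `x` controls only its component of degree `m`, while that of `r * x`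
    -- involves others; so a second induction on `x` runs over all `r`.
    clear * - hx' hδ
    induction hx' using Submodule.span_induction generalizing r with
    | mem x hx =>
      obtain ⟨a, ha, rfl⟩ := hx
      rw [smul_eq_mul, DirectSum.coe_decompose_mul_of_right_mem 𝒜 m (hδ a)]
      split_ifs with h
      · exact Ideal.mul_mem_left _ _ (Ideal.subset_span ⟨a, ⟨ha, h⟩, rfl⟩)
      · exact zero_mem _
    | zero => simp
    | add x y _ _ hx hy => simpa [mul_add] using add_mem (hx r) (hy r)
    | smul t x _ hx => simpa [mul_assoc] using hx (r * t)

-- Take degree `m` components of any decomposition. The case `r = 0` guards against the truncated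
-- subtraction `m - e`.
variable {𝒜} in
theorem mem_sup_span_singleton_iff_of_mem {J : Ideal R} (hJ : J.IsHomogeneous 𝒜) {f : R} {e : ℕ}
    (hf : f ∈ 𝒜 e) {m : ℕ} {x : R} (hx : x ∈ 𝒜 m) :
    x ∈ J ⊔ Ideal.span {f} ↔
      ∃ j ∈ J, j ∈ 𝒜 m ∧ ∃ r : R, (e ≤ m → r ∈ 𝒜 (m - e)) ∧ (¬ e ≤ m → r = 0) ∧ j + r * f = x := by
  constructor
  · intro h
    obtain ⟨j, hj, y, hy, rfl⟩ := Submodule.mem_sup.1 h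
    obtain ⟨r, rfl⟩ := Ideal.mem_span_singleton'.1 hy
    refine ⟨DirectSum.decompose 𝒜 j m, hJ m hj, SetLike.coe_mem _,
      if e ≤ m then DirectSum.decompose 𝒜 r (m - e) else 0, ?_, ?_, ?_⟩
    · intro h; rw [if_pos h]; exact SetLike.coe_mem _
    · intro h; rw [if_neg h]
    · conv_rhs => rw [← DirectSum.decompose_of_mem_same 𝒜 hx]
      rw [DirectSum.decompose_add, DirectSum.add_apply, Submodule.coe_add,
        DirectSum.coe_decompose_mul_of_right_mem 𝒜 m hf]
      split_ifs <;> simp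
  · rintro ⟨j, hj, -, r, -, -, rfl⟩
    exact Submodule.add_mem_sup hj (Ideal.mem_span_singleton'.2 ⟨r, rfl⟩)

variable [∀ n, FiniteDimensional k (𝒜 n)]

theorem finrank_quotientGrading_sup_of_lt {J : Ideal R} (hJ : J.IsHomogeneous 𝒜) {f : R} {e : ℕ}
    (hf : f ∈ 𝒜 e) {m : ℕ} (hm : m < e) :
    Module.finrank k (quotientGrading 𝒜 (J ⊔ Ideal.span {f}) m) =
      Module.finrank k (quotientGrading 𝒜 J m) := by
  have h1 := finrank_quotientGrading_add 𝒜 J m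
  have h2 := finrank_quotientGrading_add 𝒜 (J ⊔ Ideal.span {f}) m
  have : 𝒜 m ⊓ (J ⊔ Ideal.span {f}).restrictScalars k = 𝒜 m ⊓ J.restrictScalars k := by
    ext x
    refine and_congr_right fun hx => ?_
    refine (mem_sup_span_singleton_iff_of_mem hJ hf hx).trans ⟨?_, fun h => ?_⟩
    · rintro ⟨j, hj, -, r, -, hr, rfl⟩
      simpa [hr hm.not_ge] using hj
    · exact ⟨x, h, hx, 0, by simp, by simp, by simp⟩
  rw [this] at h2
  lia

/-- If multiplication by a homogeneous element `f` of degree `e` is injective on `R / J` in degree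
`m`, then the dimensions of the pieces of `R / (J + (f))` and `R / J` are related. -/
theorem finrank_quotientGrading_sup_add [IsDomain R] {J : Ideal R} (hJ : J.IsHomogeneous 𝒜) {f : R}
    {e : ℕ} (hf : f ∈ 𝒜 e) (hf0 : f ≠ 0) {m : ℕ} (hinj : ∀ g ∈ 𝒜 m, g * f ∈ J → g ∈ J) :
    Module.finrank k (quotientGrading 𝒜 (J ⊔ Ideal.span {f}) (m + e)) +
      Module.finrank k (quotientGrading 𝒜 J m) =
      Module.finrank k (quotientGrading 𝒜 J (m + e)) := by
  have h1 := finrank_quotientGrading_add 𝒜 J m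
  have h2 := finrank_quotientGrading_add 𝒜 J (m + e)
  have h3 := finrank_quotientGrading_add 𝒜 (J ⊔ Ideal.span {f}) (m + e)
  have hμ : Function.Injective (LinearMap.mulRight k f) := fun _ _ h => mul_right_cancel₀ hf0 h
  -- In degree `m + e`, the ideal `J + (f)` is the sum of the part of `J` and `f * 𝒜 m`. By `hinj`
  -- these meet in `f` times the degree `m` part of `J`, and dimensions are then counted.
  have h4 : (𝒜 (m + e) ⊓ J.restrictScalars k) ⊔ (𝒜 m).map (LinearMap.mulRight k f) =
      𝒜 (m + e) ⊓ (J ⊔ Ideal.span {f}).restrictScalars k := by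
    ext x
    constructor
    · intro h
      obtain ⟨j, hj, y, hy, rfl⟩ := Submodule.mem_sup.1 h
      obtain ⟨r, hr, rfl⟩ := hy
      exact ⟨add_mem hj.1 (SetLike.GradedMul.mul_mem hr hf),
        Submodule.add_mem_sup hj.2 (Ideal.mem_span_singleton'.2 ⟨r, rfl⟩)⟩
    · rintro ⟨hx, hxJ⟩
      obtain ⟨j, hj, hjm, r, hr, -, rfl⟩ := (mem_sup_span_singleton_iff_of_mem hJ hf hx).1 hxJ
      refine Submodule.add_mem_sup ⟨hjm, hj⟩ ⟨r, ?_, rfl⟩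
      simpa using hr (Nat.le_add_left _ _)
  have h5 : (𝒜 (m + e) ⊓ J.restrictScalars k) ⊓ (𝒜 m).map (LinearMap.mulRight k f) =
      (𝒜 m ⊓ J.restrictScalars k).map (LinearMap.mulRight k f) := by
    ext x
    constructor
    · rintro ⟨⟨-, hxJ⟩, r, hr, rfl⟩
      exact ⟨r, ⟨hr, hinj r hr hxJ⟩, rfl⟩
    · rintro ⟨r, ⟨hr, hrJ⟩, rfl⟩
      exact ⟨⟨SetLike.GradedMul.mul_mem hr hf, Ideal.mul_mem_right _ _ hrJ⟩, r, hr, rfl⟩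
  have h6 := Submodule.finrank_sup_add_finrank_inf_eq (𝒜 (m + e) ⊓ J.restrictScalars k)
    ((𝒜 m).map (LinearMap.mulRight k f))
  rw [h4, h5, ← LinearEquiv.finrank_eq (Submodule.equivMapOfInjective _ hμ (𝒜 m)),
    ← LinearEquiv.finrank_eq (Submodule.equivMapOfInjective _ hμ (𝒜 m ⊓ _))] at h6
  lia

theorem X_pow_dvd_hilbertSeries_sup_sub [IsDomain R] {J : Ideal R} (hJ : J.IsHomogeneous 𝒜) {f : R}
    {e : ℕ} (hf : f ∈ 𝒜 e) (hf0 : f ≠ 0) {n : ℕ}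
    (hinj : ∀ m, m + e ≤ n → ∀ g ∈ 𝒜 m, g * f ∈ J → g ∈ J) :
    (PowerSeries.X : ℤ⟦X⟧) ^ (n + 1) ∣ hilbertSeries (quotientGrading 𝒜 (J ⊔ Ideal.span {f})) -
      hilbertSeries (quotientGrading 𝒜 J) * (1 - PowerSeries.X ^ e) := by
  rw [PowerSeries.X_pow_dvd_iff]
  intro m hm
  rw [mul_sub, mul_one, map_sub, map_sub, PowerSeries.coeff_mul_X_pow']
  simp only [hilbertSeries, PowerSeries.coeff_mk]
  split_ifs with h
  · obtain ⟨m, rfl⟩ := Nat.exists_eq_add_of_le' h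
    have := finrank_quotientGrading_sup_add 𝒜 hJ hf hf0 (hinj m (by lia))
    rw [Nat.add_sub_cancel]
    lia
  · rw [finrank_quotientGrading_sup_of_lt 𝒜 hJ hf (by lia)]
    ring

/-- The Hilbert series of the quotient by a finite family that is regular up to degree `n`. -/
theorem X_pow_dvd_hilbertSeries_span_image_sub [IsDomain R] {Ω : Type*} [LinearOrder Ω] {f : Ω → R}
    {δ : Ω → ℕ} (hδ : ∀ a, f a ∈ 𝒜 (δ a)) (hf0 : ∀ a, f a ≠ 0) (n : ℕ) (F : Finset Ω)
    (hF : ∀ a ∈ F, ∀ m, m + δ a ≤ n → ∀ g ∈ 𝒜 m, g * f a ∈ Ideal.span (f '' {b ∈ F | b < a}) →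
      g ∈ Ideal.span (f '' {b ∈ F | b < a})) :
    (PowerSeries.X : ℤ⟦X⟧) ^ (n + 1) ∣
      hilbertSeries (quotientGrading 𝒜 (Ideal.span (f '' (F : Set Ω)))) -
      hilbertSeries 𝒜 * ∏ a ∈ F, (1 - PowerSeries.X ^ δ a) := by
  induction F using Finset.induction_on_max with
  | empty =>
    rw [Finset.coe_empty, Set.image_empty, Ideal.span_empty, hilbertSeries_quotientGrading_bot 𝒜]
    simp
  | insert a F ha ih =>
    have haF : a ∉ F := fun h => lt_irrefl _ (ha a h)
    -- As `a` exceeds all of `F`, its predecessors are exactly `F`, and those of older elements do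
    -- not change.
    have h1 : {b | b ∈ insert a F ∧ b < a} = (F : Set Ω) := by
      ext b
      simp only [Finset.mem_insert, Set.mem_ofPred_eq, Finset.mem_coe]
      exact ⟨fun h => h.1.resolve_left h.2.ne, fun h => ⟨Or.inr h, ha b h⟩⟩
    have h2 : ∀ c ∈ F, {b | b ∈ insert a F ∧ b < c} = {b | b ∈ F ∧ b < c} := by
      intro c hc
      ext b
      simp only [Finset.mem_insert, Set.mem_ofPred_eq]
      exact ⟨fun h => ⟨h.1.resolve_left (h.2.trans (ha c hc)).ne, h.2⟩, fun h => ⟨.inr h.1, h.2⟩⟩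
    have hJ : (Ideal.span (f '' (F : Set Ω))).IsHomogeneous 𝒜 :=
      Ideal.homogeneous_span _ _ (by rintro _ ⟨b, -, rfl⟩; exact ⟨_, hδ b⟩)
    have ih' := ih fun c hc => by
      have := hF c (Finset.mem_insert_of_mem hc)
      rwa [h2 c hc] at this
    have hstep := X_pow_dvd_hilbertSeries_sup_sub 𝒜 hJ (hδ a) (hf0 a) (n := n) (by
      have := hF a (Finset.mem_insert_self _ _)
      rwa [h1] at this)
    rw [Finset.coe_insert, Set.image_insert_eq, Ideal.span_insert, sup_comm,
      Finset.prod_insert haF]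
    convert hstep.add (ih'.mul_right (1 - PowerSeries.X ^ δ a)) using 1
    ring

variable {𝒜}

/-- The partial products of a homogeneous regular sequence compute the Hilbert series of the
quotient up to any given degree. -/
theorem IsRegularSequence.eventually_X_pow_dvd [IsDomain R] {Ω : Type*} [LinearOrder Ω]
    [WellFoundedLT Ω] {f : Ω → R} (hf : IsRegularSequence f) {δ : Ω → ℕ}
    (hδ : ∀ a, f a ∈ 𝒜 (δ a)) (n : ℕ) :
    ∀ᶠ F : Finset Ω in Filter.atTop, (PowerSeries.X : ℤ⟦X⟧) ^ (n + 1) ∣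
      hilbertSeries (quotientGrading 𝒜 (Ideal.span (Set.range f))) -
      hilbertSeries 𝒜 * ∏ a ∈ F, (1 - PowerSeries.X ^ δ a) := by
  filter_upwards [Filter.eventually_ge_atTop (hf.finite_degree_le hδ n).toFinset] with F hF
  have hF' : ∀ a, δ a ≤ n → a ∈ F := fun a ha => hF (by simpa using ha)
  have hf0 : ∀ a, f a ≠ 0 := fun a h => hf.notMem_span a (h ▸ zero_mem _)
  have h1 := X_pow_dvd_hilbertSeries_span_image_sub 𝒜 hδ hf0 n F <| by
    intro a ha m hm g hg hgf
    -- Regularity puts `g` in the ideal of all predecessors of `a`; since `g` has degree at most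
    -- `n`, the predecessors in `F` suffice.
    have h2 : g ∈ Ideal.span (f '' Set.Iio a) := by
      have h3 := hf.mem_nonZeroDivisors a
      rw [← Ideal.Quotient.eq_zero_iff_mem]
      refine (mem_nonZeroDivisors_iff.1 h3).2 _ ?_
      rw [← map_mul, Ideal.Quotient.eq_zero_iff_mem]
      exact Ideal.span_mono (Set.image_mono fun b hb => hb.2) hgf
    refine Ideal.span_mono (Set.image_mono ?_) (mem_span_image_degree_le 𝒜 hδ _ hg h2)
    exact fun b hb => ⟨hF' b (by have := hb.2; lia), hb.1⟩
  have h2 : (PowerSeries.X : ℤ⟦X⟧) ^ (n + 1) ∣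
      hilbertSeries (quotientGrading 𝒜 (Ideal.span (Set.range f))) -
      hilbertSeries (quotientGrading 𝒜 (Ideal.span (f '' (F : Set Ω)))) := by
    rw [PowerSeries.X_pow_dvd_iff]
    intro m hm
    have h3 := finrank_quotientGrading_add 𝒜 (Ideal.span (Set.range f)) m
    have h4 := finrank_quotientGrading_add 𝒜 (Ideal.span (f '' (F : Set Ω))) m
    have h5 : 𝒜 m ⊓ (Ideal.span (Set.range f)).restrictScalars k =
        𝒜 m ⊓ (Ideal.span (f '' (F : Set Ω))).restrictScalars k := by
      ext x
      refine and_congr_right fun hx => ⟨fun h => ?_, fun h => ?_⟩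
      · rw [← Set.image_univ] at h
        refine Ideal.span_mono (Set.image_mono ?_) (mem_span_image_degree_le 𝒜 hδ _ hx h)
        exact fun b hb => hF' b (by have := hb.2; lia)
      · exact Ideal.span_mono (Set.image_subset_range _ _) h
    rw [h5] at h3
    simp only [hilbertSeries, map_sub, PowerSeries.coeff_mk]
    lia
  simpa using h2.add h1

end GradedRing

theorem PowerSeries.hasProd_of_eventually_X_pow_dvd {ι : Type*} {g : ι → ℤ⟦X⟧} {P : ℤ⟦X⟧}
    (h : ∀ n : ℕ, ∀ᶠ F : Finset ι in Filter.atTop, (X : ℤ⟦X⟧) ^ (n + 1) ∣ P - ∏ i ∈ F, g i) :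
    HasProd g P := by
  rw [HasProd, PowerSeries.WithPiTopology.tendsto_iff_coeff_tendsto]
  intro n
  refine tendsto_nhds_of_eventually_eq ?_
  rw [SummationFilter.unconditional_filter]
  filter_upwards [h n] with F hF
  have := PowerSeries.X_pow_dvd_iff.1 hF n (Nat.lt_succ_self n)
  rw [map_sub] at this
  exact (sub_eq_zero.1 this).symm

/-! ### The variables as a regular sequence -/

namespace MvPolynomial

/-- Membership means that every monomial is divisible by a variable from `s`, which a factor `X i`
outside `s` cannot affect. -/
theorem X_mul_mem_span_X_image_iff {σ k : Type*} [Field k] {s : Set σ} {i : σ} (hi : i ∉ s)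
    {g : MvPolynomial σ k} :
    g * X i ∈ Ideal.span (X '' s : Set (MvPolynomial σ k)) ↔ g ∈ Ideal.span (X '' s) := by
  refine ⟨fun h => ?_, fun h => Ideal.mul_mem_right _ _ h⟩
  rw [mem_ideal_span_X_image] at h ⊢
  intro m hm
  obtain ⟨j, hj, hmj⟩ := h (m + Finsupp.single i 1) (by simpa [support_mul_X] using hm)
  have hij : i ≠ j := fun h => hi (h ▸ hj)
  exact ⟨j, hj, by simpa [hij] using hmj⟩

theorem isRegularSequence_X (k : Type*) [Field k] :
    IsRegularSequence (X : ℕ → MvPolynomial ℕ k) where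
  nontrivial_quotient := by
    rw [Ideal.Quotient.nontrivial_iff, Ne, Ideal.eq_top_iff_one, ← Set.image_univ,
      mem_ideal_span_X_image]
    intro h
    obtain ⟨i, -, hi⟩ := h 0 (by simp)
    simp at hi
  mem_nonZeroDivisors i := by
    rw [mem_nonZeroDivisors_iff_right]
    intro x hx
    obtain ⟨g, rfl⟩ := Ideal.Quotient.mk_surjective x
    rw [← map_mul, Ideal.Quotient.eq_zero_iff_mem] at hx
    rw [Ideal.Quotient.eq_zero_iff_mem]
    exact (X_mul_mem_span_X_image_iff (by simp)).1 hx

variable {k : Type*} [Field k] {d : ℕ → ℕ}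

theorem finiteDimensional_weightedHomogeneousSubmodule {n : ℕ}
    (hd : {a : ℕ →₀ ℕ | Finsupp.weight d a = n}.Finite) :
    FiniteDimensional k (weightedHomogeneousSubmodule k d n) := by
  rw [weightedHomogeneousSubmodule_eq_finsupp_supported]
  have := hd.to_subtype
  exact Module.Finite.of_basis (basisRestrictSupport k {a | Finsupp.weight d a = n})

theorem weight_pos_of_finite (hd : {a : ℕ →₀ ℕ | Finsupp.weight d a = 0}.Finite) (i : ℕ) :
    0 < d i := by
  by_contra! h
  refine Set.infinite_of_injective_forall_mem
    (f := fun c : ℕ => (Finsupp.single i c : ℕ →₀ ℕ)) (Finsupp.single_injective i) ?_ hd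
  intro c
  simp [Finsupp.weight_single, Nat.le_zero.1 h]

theorem hilbertSeries_quotientGrading_span_range_X :
    hilbertSeries (quotientGrading (weightedHomogeneousSubmodule k d)
      (Ideal.span (Set.range (X : ℕ → MvPolynomial ℕ k)))) = 1 := by
  have hnt := (isRegularSequence_X k).nontrivial_quotient
  ext n
  rw [hilbertSeries, PowerSeries.coeff_mk, PowerSeries.coeff_one]
  have key (x : MvPolynomial ℕ k) :
      x - C (coeff 0 x) ∈ Ideal.span (Set.range (X : ℕ → MvPolynomial ℕ k)) := by
    rw [← Set.image_univ, mem_ideal_span_X_image]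
    intro m hm
    by_contra! h
    have : m = 0 := by ext i; simpa using h i
    simp [this] at hm
  split_ifs with hn
  · subst hn
    have : quotientGrading (weightedHomogeneousSubmodule k d)
        (Ideal.span (Set.range (X : ℕ → MvPolynomial ℕ k))) 0 = Submodule.span k {1} := by
      refine le_antisymm ?_ ?_
      · rintro _ ⟨x, hx, rfl⟩
        refine Submodule.mem_span_singleton.2 ⟨coeff 0 x, ?_⟩
        have := (Ideal.Quotient.mk_eq_mk_iff_sub_mem _ _).2 (key x)
        simp only [AlgHom.toLinearMap_apply, Ideal.Quotient.mkₐ_eq_mk, this]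
        rw [Algebra.smul_def, mul_one]
        rfl
      · rw [Submodule.span_singleton_le_iff_mem]
        exact ⟨1, isWeightedHomogeneous_one k d, map_one (Ideal.Quotient.mkₐ k _)⟩
    rw [this, finrank_span_singleton one_ne_zero, Nat.cast_one]
  · have : quotientGrading (weightedHomogeneousSubmodule k d)
        (Ideal.span (Set.range (X : ℕ → MvPolynomial ℕ k))) n = ⊥ := by
      rw [eq_bot_iff]
      rintro _ ⟨x, hx, rfl⟩
      have h0 : coeff 0 x = 0 := IsWeightedHomogeneous.coeff_eq_zero hx 0 (by simpa using Ne.symm hn)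
      have := key x
      rw [h0, map_zero, sub_zero] at this
      simpa using Ideal.Quotient.eq_zero_iff_mem.2 this
    rw [this, finrank_bot, Nat.cast_zero]

theorem IsWeightedHomogeneous.weightedTotalDegree_eq {σ R : Type*} [CommSemiring R] {w : σ → ℕ}
    {p : MvPolynomial σ R} {n : ℕ} (hp : IsWeightedHomogeneous w p n) (h : p ≠ 0) :
    weightedTotalDegree w p = n := by
  have := hp.weighted_total_degree h
  rw [weightedTotalDegree_coe w p h] at this
  exact_mod_cast this

end MvPolynomial

theorem mainTheorem8 {k : Type*} [Field k] (d : ℕ → ℕ)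
    (hd : ∀ n : ℕ, {a : ℕ →₀ ℕ | Finsupp.weight d a = n}.Finite)
    {Ω : Type*} [LinearOrder Ω] [WellFoundedLT Ω] (f : Ω → MvPolynomial ℕ k)
    (hf : IsHomogeneousRegularSequence (MvPolynomial.weightedHomogeneousSubmodule k d) f)
    (I : Ideal (MvPolynomial ℕ k)) (hI : I = Ideal.span (Set.range f)) :
    (Multipliable fun i : ℕ => Ring.inverse (1 - (PowerSeries.X : ℤ⟦X⟧) ^ d i)) ∧
    hilbertSeries (MvPolynomial.weightedHomogeneousSubmodule k d) =
      ∏' i : ℕ, Ring.inverse (1 - (PowerSeries.X : ℤ⟦X⟧) ^ d i) ∧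
    (Multipliable fun α : Ω =>
      1 - (PowerSeries.X : ℤ⟦X⟧) ^ MvPolynomial.weightedTotalDegree d (f α)) ∧
    hilbertSeries (quotientGrading (MvPolynomial.weightedHomogeneousSubmodule k d) I) =
      hilbertSeries (MvPolynomial.weightedHomogeneousSubmodule k d) *
        ∏' α : Ω, (1 - (PowerSeries.X : ℤ⟦X⟧) ^ MvPolynomial.weightedTotalDegree d (f α)) := by
  let 𝒜 := MvPolynomial.weightedHomogeneousSubmodule k d
  let : GradedAlgebra 𝒜 := MvPolynomial.weightedGradedAlgebra k d
  have : ∀ n, FiniteDimensional k (𝒜 n) := fun n =>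
    MvPolynomial.finiteDimensional_weightedHomogeneousSubmodule (hd n)
  -- Positive weights make each `1 - X ^ d i` a unit, so that `Ring.inverse` is not its default
  -- value `0`.
  have hpos := MvPolynomial.weight_pos_of_finite (hd 0)
  have hX := (MvPolynomial.isRegularSequence_X k).eventually_X_pow_dvd (𝒜 := 𝒜) (δ := d)
    (MvPolynomial.isWeightedHomogeneous_X k d)
  rw [MvPolynomial.hilbertSeries_quotientGrading_span_range_X] at hX
  have hunit : ∀ i, IsUnit (1 - (PowerSeries.X : ℤ⟦X⟧) ^ d i) := fun i => by
    simp [PowerSeries.isUnit_iff_constantCoeff, (hpos i).ne']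
  have hS : HasProd (fun i : ℕ => Ring.inverse (1 - (PowerSeries.X : ℤ⟦X⟧) ^ d i))
      (hilbertSeries 𝒜) := by
    refine PowerSeries.hasProd_of_eventually_X_pow_dvd fun n => ?_
    filter_upwards [hX n] with F hF
    have h1 : (∏ i ∈ F, (1 - (PowerSeries.X : ℤ⟦X⟧) ^ d i)) *
        ∏ i ∈ F, Ring.inverse (1 - (PowerSeries.X : ℤ⟦X⟧) ^ d i) = 1 := by
      rw [← Finset.prod_mul_distrib]
      exact Finset.prod_eq_one fun i _ => Ring.mul_inverse_cancel _ (hunit i)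
    convert (hF.mul_right (∏ i ∈ F, Ring.inverse (1 - (PowerSeries.X : ℤ⟦X⟧) ^ d i))).neg_right
      using 1
    linear_combination (-hilbertSeries 𝒜) * h1
  have hSunit : IsUnit (hilbertSeries 𝒜) := by
    obtain ⟨F, hF⟩ := (hX 0).exists
    have := PowerSeries.X_pow_dvd_iff.1 hF 0 Nat.one_pos
    rw [PowerSeries.isUnit_iff_constantCoeff]
    rw [map_sub, sub_eq_zero] at this
    simp only [PowerSeries.coeff_zero_eq_constantCoeff, map_mul, map_one] at this
    exact .of_mul_eq_one _ this.symm
  -- Dividing by `H_S` isolates the product over the sequence as the limit `W * H_{S/I}`.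
  obtain ⟨W, hW⟩ := hSunit.exists_right_inv
  have hδ : ∀ a, f a ∈ 𝒜 (MvPolynomial.weightedTotalDegree d (f a)) := fun a => by
    obtain ⟨n, hn⟩ := hf.isHomogeneousElem a
    have h0 : f a ≠ 0 := fun h => hf.isRegularSequence.notMem_span a (h ▸ zero_mem _)
    rwa [MvPolynomial.IsWeightedHomogeneous.weightedTotalDegree_eq hn h0]
  have hI' : HasProd (fun α : Ω =>
      1 - (PowerSeries.X : ℤ⟦X⟧) ^ MvPolynomial.weightedTotalDegree d (f α))
      (W * hilbertSeries (quotientGrading 𝒜 I)) := by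
    refine PowerSeries.hasProd_of_eventually_X_pow_dvd fun n => ?_
    filter_upwards [hf.isRegularSequence.eventually_X_pow_dvd hδ n] with F hF
    rw [hI]
    convert hF.mul_left W using 1
    linear_combination (∏ a ∈ F, (1 - (PowerSeries.X : ℤ⟦X⟧) ^
      MvPolynomial.weightedTotalDegree d (f a))) * hW
  refine ⟨hS.multipliable, hS.tprod_eq.symm, hI'.multipliable, ?_⟩
  rw [hI'.tprod_eq]
  linear_combination (-hilbertSeries (quotientGrading 𝒜 I)) * hW
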